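/- All graphs are finite and simple. For a connected graph $G$ and an integer $h\ge 0$, an $h$-extra edge-cut of $G$ is a set $F\subseteq E(G)$ such that $G-F$ is disconnected and every connected component of $G-F$ has more than $h$ vertices; $\lambda^{(h)}(G)$ denotes the minimum cardinality of an $h$-extra edge-cut, if one exists. Let $\xi_h(G)$ be the minimum, over all $X\subset V(G)$ with $|X|=h+1$ and $G[X]$ connected, of the number of edges of $G$ with exactly one end in $X$. A connected graph $G$ is super-$\lambda^{(h)}$ if $\lambda^{(h)}(G)$ exists, $\lambda^{(h)}(G)=\xi_h(G)$, and for every $h$-extra edge-cut $F$ of $G$ with $|F|=\lambda^{(h)}(G)$ some connected component of $G-F$ has exactly $h+1$ vertices; disconnected graphs are not super-$\lambda^{(h)}$. For a super-$\lambda^{(1)}$ graph $G$, the persistence $\rho'(G)=\rho^{(1)}(G)$ is the maximum integer $m$ such that $G-F$ is super-$\lambda^{(1)}$ for every $F\subseteq E(G)$ with $|F|\le m$. **Corollary 3.11.** Let $G$ be a connected vertex-transitive graph of degree $k\ge 4$ with girth at least $5$. Then $G$ is super-$\lambda^{(1)}$ and $\rho'(G)=k-1$. -/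

import Mathlib

namespace SimpleGraph

variable {V : Type*}

/-- A graph is vertex-transitive (transitive) if its automorphism group acts transitively on the
vertices. -/
def IsVertexTransitive (G : SimpleGraph V) : Prop :=
  ∀ u v : V, ∃ φ : G ≃g G, φ u = v

/-- The set of edges of `G` with one end in `X` and the other outside `X`. -/
def edgeBdry (G : SimpleGraph V) (X : Set V) : Set (Sym2 V) :=
  {e | e ∈ G.edgeSet ∧ ∃ x ∈ X, ∃ y ∉ X, e = s(x, y)}

/-- An `h`-extra edge-cut: a set `F` of edges of `G` such that `G - F` is disconnected and every
connected component of `G - F` has more than `h` vertices. -/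
def IsExtraEdgeCut (G : SimpleGraph V) (h : ℕ) (F : Set (Sym2 V)) : Prop :=
  F ⊆ G.edgeSet ∧ ¬ (G.deleteEdges F).Preconnected ∧
    ∀ C : (G.deleteEdges F).ConnectedComponent, (h : ℕ∞) < C.supp.encard

/-- The `h`-extra edge-connectivity: the minimum cardinality of an `h`-extra edge-cut.
On a finite graph the value is `⊤` exactly when there is no `h`-extra edge-cut. -/
noncomputable def extraEdgeConnectivity (G : SimpleGraph V) (h : ℕ) : ℕ∞ :=
  ⨅ F ∈ {F : Set (Sym2 V) | G.IsExtraEdgeCut h F}, F.encard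

/-- The minimum of `|E_G(X)|` over all sets `X` of `h + 1` vertices inducing a connected subgraph
(`⊤` if there is no such `X`). For `h = 0` this is the minimum degree, for `h = 1` the minimum
edge-degree. -/
noncomputable def extraXi (G : SimpleGraph V) (h : ℕ) : ℕ∞ :=
  ⨅ X ∈ {X : Set V | X.encard = (h : ℕ∞) + 1 ∧ (G.induce X).Connected}, (G.edgeBdry X).encard

/-- A connected graph is optimal with respect to its `h`-extra edge-connectivity if the latter
exists and equals `extraXi`. -/
def IsExtraOptimal (G : SimpleGraph V) (h : ℕ) : Prop :=
  G.Connected ∧ (∃ F, G.IsExtraEdgeCut h F) ∧ G.extraEdgeConnectivity h = G.extraXi h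

/-- A graph is super `h`-extra edge-connected if it is optimal and every minimum `h`-extra edge-cut
`F` isolates a connected subgraph of order `h + 1`, that is, some connected component of `G - F`
has exactly `h + 1` vertices. -/
def IsSuperExtra (G : SimpleGraph V) (h : ℕ) : Prop :=
  G.IsExtraOptimal h ∧
    ∀ F, G.IsExtraEdgeCut h F → F.encard = G.extraEdgeConnectivity h →
      ∃ C : (G.deleteEdges F).ConnectedComponent, C.supp.encard = (h : ℕ∞) + 1

/-- `m` is the persistence of the super `h`-extra edge-connected graph `G`: the maximum integer
such that `G - F` is super `h`-extra edge-connected for every set `F` of at most `m` edges.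
(As `G` itself is super `h`-extra edge-connected, the maximum is nonnegative.) -/
def IsPersistence (G : SimpleGraph V) (h m : ℕ) : Prop :=
  G.IsSuperExtra h ∧
    IsGreatest {m : ℕ | ∀ F : Set (Sym2 V), F ⊆ G.edgeSet → F.encard ≤ m →
      (G.deleteEdges F).IsSuperExtra h} m

end SimpleGraph

/-!
Let `c(A)` be the number of edges of `G` leaving the vertex set `A`. Everything follows from the lower
bound `c(A) ≥ 3k - 4`, for `A` with at least three vertices inside and outside, in which equality
needs exactly three vertices on one side.

For sets that are not too large the bound is a matter of girth alone: counting paths of length two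
inside `A` shows that the average inner degree is at most `√(|A| - 1)` (`adjCount_self_sq_le`), so
a set of four or more vertices with `c(A) ≤ 3k - 4` has more than `(k - 1) ^ 2 + 1` vertices
(`lt_card_of_adjCount_compl_le`). Vertex-transitivity excludes these: by submodularity, a minimal
such set is a block of imprimitivity, whose vertices all have equally many, hence at least one,
neighbours outside, and `c(A) ≥ |A|` is too large (`three_mul_lt_adjCount_compl`).

Now delete a set `F` of at most `k - 1` edges. In `G - F` the boundary of an edge `uv` has `2k - 2`
edges, less one for each incidence of `F` with `u` or `v`. A suitable edge next to `F` makes this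
smaller than the boundary in `G - F` of any set `A` as above (`exists_adj_adjCount_lt`), the case of
equality in the lower bound being the delicate one (`exists_adj_of_card_eq_three`). So a minimum
`1`-extra edge-cut must cut off a single edge (`le_encard_of_isExtraEdgeCut`), and conversely the
least boundary of an edge is such a cut (`isExtraEdgeCut_edgeBdry_pair`). The bound `k - 1` is sharp
because the `k` edges at a vertex disconnect the graph.
-/

namespace SimpleGraph

/-! ### Forbidden short cycles -/

section

variable {V : Type*}

theorem not_adj_of_common_neighbor {G : SimpleGraph V} (hg : 5 ≤ G.egirth) {x y z : V}
    (hxy : G.Adj x y) (hyz : G.Adj y z) : ¬ G.Adj x z := by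
  intro hxz
  have := le_egirth.mp hg x (.cons hxy (.cons hyz (.cons hxz.symm .nil))) (by
    simp [Walk.isCycle_def, Walk.isTrail_def, hxy.ne, hyz.ne, hxz.ne, hxy.ne', hxz.ne'])
  norm_num at this

theorem eq_of_common_neighbors {G : SimpleGraph V} (hg : 5 ≤ G.egirth) {x y z w : V}
    (hxz : x ≠ z) (hxy : G.Adj x y) (hyz : G.Adj y z) (hxw : G.Adj x w) (hwz : G.Adj w z) :
    y = w := by
  by_contra hyw
  have := le_egirth.mp hg x (.cons hxy (.cons hyz (.cons hwz.symm (.cons hxw.symm .nil)))) (by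
    simp [Walk.isCycle_def, Walk.isTrail_def, hxy.ne, hyz.ne, hxw.ne, hxy.ne', hxw.ne', hwz.ne',
      hyw, hxz, Ne.symm hxz])
  norm_num at this

end

/-! ### Counting edges across a vertex set -/

open scoped Classical in
/-- The number of ordered pairs `(x, y) ∈ A × B` with `x` adjacent to `y`. For disjoint `A`, `B` this
is the number of edges between them; for `A = B` it is twice the number of edges inside `A`. -/
noncomputable def adjCount {V : Type*} (G : SimpleGraph V) (A B : Finset V) : ℕ :=
  ∑ x ∈ A, ∑ y ∈ B, if G.Adj x y then 1 else 0

section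

open Finset
open scoped Classical

variable {V : Type*}

theorem adjCount_comm (G : SimpleGraph V) (A B : Finset V) : G.adjCount A B = G.adjCount B A := by
  unfold adjCount
  rw [sum_comm]
  simp only [G.adj_comm]

theorem adjCount_eq_sum_singleton (G : SimpleGraph V) (A B : Finset V) :
    G.adjCount A B = ∑ x ∈ A, G.adjCount {x} B := by
  simp [adjCount]

theorem adjCount_singleton (G : SimpleGraph V) (x : V) (B : Finset V) :
    G.adjCount {x} B = #{y ∈ B | G.Adj x y} := by
  simp [adjCount]

theorem adjCount_singleton_pos {G : SimpleGraph V} {x : V} {B : Finset V} :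
    0 < G.adjCount {x} B ↔ ∃ y ∈ B, G.Adj x y := by
  simp [adjCount_singleton, card_pos, filter_nonempty_iff]

theorem adjCount_singleton_le_one {G : SimpleGraph V} {x u : V} (h : ∀ y, G.Adj x y → y = u)
    (B : Finset V) : G.adjCount {x} B ≤ 1 := by
  rw [adjCount_singleton, card_le_one]
  intro y hy z hz
  rw [h y (mem_filter.mp hy).2, h z (mem_filter.mp hz).2]

theorem adjCount_map (G : SimpleGraph V) (φ : G ≃g G) (A B : Finset V) :
    G.adjCount (A.map φ.toEquiv.toEmbedding) (B.map φ.toEquiv.toEmbedding) = G.adjCount A B := by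
  simp only [adjCount, sum_map]
  exact sum_congr rfl fun x _ => sum_congr rfl fun y _ => if_congr φ.map_adj_iff rfl rfl

variable [Fintype V]

theorem adjCount_compl_compl (G : SimpleGraph V) (A : Finset V) :
    G.adjCount Aᶜ Aᶜᶜ = G.adjCount A Aᶜ := by
  rw [compl_compl, adjCount_comm]

theorem adjCount_compl_add_adjCount_self (G : SimpleGraph V) (A : Finset V) :
    G.adjCount A Aᶜ + G.adjCount A A = ∑ x ∈ A, G.adjCount {x} univ := by
  simp only [adjCount, sum_singleton, ← sum_add_distrib]
  refine sum_congr rfl fun x _ => ?_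
  rw [add_comm]
  exact sum_add_sum_compl A _

theorem adjCount_singleton_compl (G : SimpleGraph V) (x : V) :
    G.adjCount {x} {x}ᶜ = G.adjCount {x} univ := by
  have h := G.adjCount_compl_add_adjCount_self {x}
  simpa [show G.adjCount {x} {x} = 0 by simp [adjCount]] using h

theorem adjCount_pair (G : SimpleGraph V) {u v : V} (huv : u ≠ v) :
    G.adjCount {u, v} {u, v}ᶜ + (if G.Adj u v then 2 else 0) =
      G.adjCount {u} univ + G.adjCount {v} univ := by
  have h := G.adjCount_compl_add_adjCount_self {u, v}
  rw [sum_pair huv] at h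
  rw [← h, add_right_inj]
  simp only [adjCount, sum_pair huv, SimpleGraph.irrefl, G.adj_comm v u]
  by_cases h : G.Adj u v <;> simp [h]

/-- The edge boundary is submodular. -/
theorem adjCount_compl_inter_add_union_le (G : SimpleGraph V) (A B : Finset V) :
    G.adjCount (A ∩ B) (A ∩ B)ᶜ + G.adjCount (A ∪ B) (A ∪ B)ᶜ ≤
      G.adjCount A Aᶜ + G.adjCount B Bᶜ := by
  have key : ∀ C : Finset V, G.adjCount C Cᶜ =
      ∑ x, ∑ y, if x ∈ C ∧ y ∉ C ∧ G.Adj x y then 1 else 0 := by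
    intro C
    unfold adjCount
    rw [← sum_filter_add_sum_filter_not univ (· ∈ C)]
    rw [sum_eq_zero (s := univ.filter (· ∉ C)), add_zero]
    · rw [filter_mem_eq_inter, univ_inter]
      refine sum_congr rfl fun x hx => ?_
      rw [← sum_filter_add_sum_filter_not univ (· ∈ C)]
      rw [sum_eq_zero (s := univ.filter (· ∈ C)), zero_add]
      · have : univ.filter (· ∉ C) = Cᶜ := by ext; simp
        rw [this]
        refine sum_congr rfl fun y hy => ?_
        simp [hx, mem_compl.mp hy]
      · intro y hy
        simp [(mem_filter.mp hy).2]
    · intro x hx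
      simp [(mem_filter.mp hx).2]
  simp only [key, ← sum_add_distrib]
  refine sum_le_sum fun x _ => sum_le_sum fun y _ => ?_
  simp only [mem_inter, mem_union]
  by_cases x ∈ A <;> by_cases x ∈ B <;> by_cases y ∈ A <;> by_cases y ∈ B <;>
    by_cases G.Adj x y <;> simp_all

theorem adjCount_compl_sdiff_add_sdiff_le (G : SimpleGraph V) (A B : Finset V) :
    G.adjCount (A \ B) (A \ B)ᶜ + G.adjCount (B \ A) (B \ A)ᶜ ≤
      G.adjCount A Aᶜ + G.adjCount B Bᶜ := by
  have h := G.adjCount_compl_inter_add_union_le A Bᶜ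
  have e1 : A ∩ Bᶜ = A \ B := by ext; simp
  have e2 : A ∪ Bᶜ = (B \ A)ᶜ := by ext; simp; tauto
  rwa [e1, e2, adjCount_compl_compl, adjCount_compl_compl] at h

theorem encard_edgeBdry (G : SimpleGraph V) (A : Finset V) :
    (G.edgeBdry ↑A).encard = G.adjCount A Aᶜ := by
  have hc : G.adjCount A Aᶜ = #{p ∈ A ×ˢ Aᶜ | G.Adj p.1 p.2} := by
    rw [card_filter, sum_product, adjCount]
  have himg : G.edgeBdry ↑A =
      (fun p : V × V => s(p.1, p.2)) '' ↑({p ∈ A ×ˢ Aᶜ | G.Adj p.1 p.2} : Finset (V × V)) := by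
    ext e
    simp only [edgeBdry, Set.mem_ofPred_eq, Set.mem_image, Finset.mem_coe, mem_filter, mem_product,
      mem_compl, Prod.exists]
    constructor
    · rintro ⟨he, x, hx, y, hy, rfl⟩
      exact ⟨x, y, ⟨⟨hx, hy⟩, he⟩, rfl⟩
    · rintro ⟨x, y, ⟨⟨hx, hy⟩, he⟩, rfl⟩
      exact ⟨he, x, hx, y, hy, rfl⟩
  rw [himg, Set.InjOn.encard_image, Set.encard_coe_eq_coe_finsetCard, hc]
  rintro ⟨a, b⟩ h1 ⟨c, d⟩ h2 h
  simp only [Finset.mem_coe, mem_filter, mem_product, mem_compl] at h1 h2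
  rcases Sym2.eq_iff.mp h with ⟨rfl, rfl⟩ | ⟨rfl, rfl⟩
  · rfl
  · exact absurd h1.1.1 h2.1.2

theorem adjCount_compl_pos_of_reachable {G : SimpleGraph V} {A : Finset V} {u v : V}
    (h : G.Reachable u v) (hu : u ∈ A) (hv : v ∉ A) : 0 < G.adjCount A Aᶜ := by
  obtain ⟨w⟩ := h
  obtain ⟨d, -, h1, h2⟩ := w.exists_boundary_dart (↑A) hu hv
  rw [adjCount_eq_sum_singleton]
  refine sum_pos' (fun _ _ => Nat.zero_le _) ⟨d.fst, h1, ?_⟩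
  rw [adjCount_singleton, card_pos]
  exact ⟨d.snd, mem_filter.mpr ⟨mem_compl.mpr h2, d.adj⟩⟩

end

/-! ### Edge boundaries in graphs of girth at least five -/

section

open Finset
open scoped Classical

variable {V : Type*}

/-- Counting the paths `x, y, z` inside `A`: two distinct vertices have at most one common
neighbour, and none if they are adjacent. -/
theorem sum_sq_adjCount_singleton_le {G : SimpleGraph V} (hg : 5 ≤ G.egirth) (A : Finset V) :
    ∑ y ∈ A, G.adjCount {y} A ^ 2 + #A ≤ #A ^ 2 := by
  have h1 : ∑ y ∈ A, G.adjCount {y} A ^ 2 =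
      ∑ x ∈ A, ∑ z ∈ A, #{y ∈ A | G.Adj x y ∧ G.Adj y z} := by
    simp only [card_filter]
    rw [sum_congr rfl fun x _ => sum_comm, sum_comm]
    refine sum_congr rfl fun y _ => ?_
    simp only [adjCount, sum_singleton]
    rw [sq, sum_mul_sum]
    refine sum_congr rfl fun x _ => sum_congr rfl fun z _ => ?_
    rw [G.adj_comm x y]
    by_cases G.Adj y x <;> by_cases G.Adj y z <;> simp_all
  have h2 : ∀ x ∈ A, ∀ z ∈ A, #{y ∈ A | G.Adj x y ∧ G.Adj y z} + (if G.Adj x z then 1 else 0) +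
      (if x = z then 1 else 0) ≤ 1 + if x = z then G.adjCount {x} A else 0 := by
    intro x hx z hz
    by_cases hxz : x = z
    · subst hxz
      simp only [SimpleGraph.irrefl, if_true, if_false, adjCount_singleton]
      have : #{y ∈ A | G.Adj x y ∧ G.Adj y x} ≤ #{y ∈ A | G.Adj x y} :=
        card_le_card fun y hy => by simp at hy ⊢; tauto
      omega
    · simp only [hxz, if_false, add_zero]
      split_ifs with ha
      · rw [card_eq_zero.mpr]
        rw [filter_eq_empty_iff]
        rintro y - ⟨hxy, hyz⟩
        exact not_adj_of_common_neighbor hg hxy hyz ha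
      · rw [add_zero, card_le_one]
        intro y hy w hw
        simp only [mem_filter] at hy hw
        exact eq_of_common_neighbors hg hxz hy.2.1 hy.2.2 hw.2.1 hw.2.2
  have h3 := sum_le_sum fun x hx => sum_le_sum (h2 x hx)
  simp only [sum_add_distrib, ← h1] at h3
  have h4 : ∑ x ∈ A, ∑ z ∈ A, (if x = z then 1 else 0) = #A := by simp
  have h5 : ∑ x ∈ A, ∑ z ∈ A, (if x = z then G.adjCount {x} A else 0) =
      ∑ x ∈ A, ∑ z ∈ A, if G.Adj x z then 1 else 0 := by
    refine sum_congr rfl fun x hx => ?_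
    rw [sum_ite_eq, if_pos hx]
    simp [adjCount]
  rw [h4, h5] at h3
  simp only [sum_const, smul_eq_mul, mul_one] at h3
  nlinarith

/-- A graph of girth at least five on `m` vertices has average degree at most `√(m - 1)`. -/
theorem adjCount_self_sq_le {G : SimpleGraph V} (hg : 5 ≤ G.egirth) (A : Finset V) :
    G.adjCount A A ^ 2 + #A ^ 2 ≤ #A ^ 3 := by
  have h1 := sum_sq_adjCount_singleton_le hg A
  have h2 : (∑ x ∈ A, G.adjCount {x} A) ^ 2 ≤ #A * ∑ x ∈ A, G.adjCount {x} A ^ 2 :=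
    sq_sum_le_card_mul_sum_sq
  rw [← adjCount_eq_sum_singleton] at h2
  nlinarith [Nat.mul_le_mul_left (#A) h1]

variable [Fintype V]

/-- The lower bounds on the edge boundary of a set of at most three vertices. -/
theorem adjCount_compl_lower_bounds_small {G : SimpleGraph V} {k : ℕ} (hg : 5 ≤ G.egirth)
    (hd : ∀ x, G.adjCount {x} univ = k) (A : Finset V) :
    (#A = 2 → 2 * k ≤ G.adjCount A Aᶜ + 2) ∧ (#A = 3 → 3 * k ≤ G.adjCount A Aᶜ + 4) := by
  have h1 := adjCount_self_sq_le hg A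
  have h2 := G.adjCount_compl_add_adjCount_self A
  simp only [hd, sum_const, smul_eq_mul] at h2
  refine ⟨fun h => ?_, fun h => ?_⟩ <;> rw [h] at h1 h2
  · have : G.adjCount A A ≤ 2 := by nlinarith
    omega
  · have : G.adjCount A A ≤ 4 := by nlinarith
    omega

/-- The bound on the average inner degree, made numerical: only a set with more than `(k - 1) ^ 2 + 1`
vertices can have fewer than `3k - 3` boundary edges, unless it has at most three vertices. -/
theorem lt_card_of_adjCount_compl_le {G : SimpleGraph V} {k : ℕ} (hg : 5 ≤ G.egirth)
    (hk : 4 ≤ k) (hd : ∀ x, G.adjCount {x} univ = k) {A : Finset V} (hA : 4 ≤ #A)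
    (hc : G.adjCount A Aᶜ + 4 ≤ 3 * k) : (k - 1) ^ 2 + 1 < #A := by
  have h1 := adjCount_self_sq_le hg A
  have h2 := G.adjCount_compl_add_adjCount_self A
  simp only [hd, sum_const, smul_eq_mul] at h2
  obtain ⟨j, rfl⟩ : ∃ j, k = j + 1 := ⟨k - 1, by omega⟩
  simp only [Nat.add_sub_cancel]
  generalize G.adjCount A A = S at *
  generalize G.adjCount A Aᶜ = c at *
  generalize #A = m at *
  zify at *
  by_cases hm : (3 * j : ℤ) ≤ m
  · -- fewer boundary edges than vertices: the average inner degree exceeds `k - 1`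
    have hS : j * m < (S : ℤ) := by nlinarith
    have hS2 : (j * m : ℤ) ^ 2 < (S : ℤ) ^ 2 := by
      have : (0 : ℤ) ≤ j * m := by positivity
      nlinarith
    have h3 : (m : ℤ) ^ 2 * (j ^ 2 + 1) < m ^ 2 * m := by nlinarith
    exact lt_of_mul_lt_mul_left h3 (by positivity)
  · exfalso
    by_cases h6 : 6 ≤ (m : ℤ)
    · -- `k ≥ (m + 4) / 3`, whence `S ≥ m (m + 1) / 3`, which exceeds `m √(m - 1)`
      have hS : (m : ℤ) * (m + 1) ≤ 3 * S := by nlinarith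
      have hS2 : ((m : ℤ) * (m + 1)) ^ 2 ≤ (3 * S) ^ 2 := by
        have : (0 : ℤ) ≤ m * (m + 1) := by positivity
        nlinarith
      have h3 : (m : ℤ) ^ 2 * ((m + 1) ^ 2 + 9) ≤ m ^ 2 * (9 * m) := by nlinarith
      have h4 := le_of_mul_le_mul_left h3 (by positivity)
      nlinarith
    · obtain h | h : (m : ℤ) = 4 ∨ (m : ℤ) = 5 := by omega
      · rw [h] at h1 h2
        nlinarith
      · rw [h] at h1 h2
        nlinarith

end

section

open Finset
open scoped Classical
variable {V : Type*} [Fintype V]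

/-! ### Large sets in vertex-transitive graphs -/

theorem compl_map_iso {G : SimpleGraph V} (φ : G ≃g G) (A : Finset V) :
    (A.map φ.toEquiv.toEmbedding)ᶜ = Aᶜ.map φ.toEquiv.toEmbedding := by
  ext x
  simp

/-- If every automorphism maps `A` to itself or off itself, then all vertices of `A` have equally many
neighbours outside `A`; in a connected graph that number is positive. -/
theorem card_le_adjCount_compl_of_isBlock {G : SimpleGraph V} (htrans : G.IsVertexTransitive)
    {A : Finset V} (hpos : 0 < G.adjCount A Aᶜ)
    (hblock : ∀ φ : G ≃g G, A.map φ.toEquiv.toEmbedding = A ∨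
      Disjoint (A.map φ.toEquiv.toEmbedding) A) :
    #A ≤ G.adjCount A Aᶜ := by
  rw [adjCount_eq_sum_singleton] at hpos ⊢
  obtain ⟨x, hx, hx0⟩ := sum_pos_iff.mp hpos
  rw [card_eq_sum_ones]
  refine sum_le_sum fun y hy => ?_
  obtain ⟨φ, rfl⟩ := htrans x y
  have hA : A.map φ.toEquiv.toEmbedding = A := by
    refine (hblock φ).resolve_right fun h => ?_
    exact Finset.disjoint_left.mp h (mem_map_of_mem φ.toEquiv.toEmbedding hx) hy
  have h := G.adjCount_map φ {x} Aᶜ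
  rw [← compl_map_iso, hA, map_singleton] at h
  exact hx0.trans_eq h.symm

/-- In a vertex-transitive graph of girth at least five, a set with at least four vertices inside and
outside has a boundary of at least `3k - 3` edges. A minimal counterexample meets each of its images
under automorphisms in everything or nothing, by submodularity: both the intersection and the two
differences would be smaller counterexamples. So its boundary has at least as many edges as it has
vertices, and these are too many for so small a boundary. -/
theorem three_mul_lt_adjCount_compl {G : SimpleGraph V} {k : ℕ} (hconn : G.Connected)
    (htrans : G.IsVertexTransitive) (hg : 5 ≤ G.egirth) (hk : 4 ≤ k)
    (hd : ∀ x, G.adjCount {x} univ = k) {A : Finset V} (hA : 4 ≤ #A) (hA' : 4 ≤ #Aᶜ) :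
    3 * k < G.adjCount A Aᶜ + 4 := by
  by_contra! hlt
  have hbig : ∀ B : Finset V, 4 ≤ #B → G.adjCount B Bᶜ + 4 ≤ 3 * k → 10 < #B ∧ 3 * k < #B + 4 := by
    intro B hB hc
    have := lt_card_of_adjCount_compl_le hg hk hd hB hc
    obtain ⟨j, rfl⟩ : ∃ j, k = j + 1 := ⟨k - 1, by omega⟩
    simp only [Nat.add_sub_cancel] at this
    constructor <;> nlinarith
  -- minimise the boundary first, then the number of vertices
  let S : Finset (Finset V) := {B | 4 ≤ #B ∧ 4 ≤ #Bᶜ}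
  have hS : ∀ B, B ∈ S ↔ 4 ≤ #B ∧ 4 ≤ #Bᶜ := fun B => by simp [S]
  obtain ⟨B₀, hB₀, hmin₀⟩ := S.exists_min_image (fun B => G.adjCount B Bᶜ) ⟨A, (hS A).mpr ⟨hA, hA'⟩⟩
  let T : Finset (Finset V) := {B ∈ S | G.adjCount B Bᶜ = G.adjCount B₀ B₀ᶜ}
  obtain ⟨B, hBT, hmin⟩ := T.exists_min_image card ⟨B₀, by simp [T, hB₀]⟩
  obtain ⟨hBS, hBc⟩ := mem_filter.mp hBT
  have hle : ∀ C, 4 ≤ #C → 4 ≤ #Cᶜ → G.adjCount B Bᶜ ≤ G.adjCount C Cᶜ := fun C h h' =>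
    hBc ▸ hmin₀ C ((hS C).mpr ⟨h, h'⟩)
  have hsmall : ∀ C, 4 ≤ #C → 4 ≤ #Cᶜ → G.adjCount C Cᶜ ≤ G.adjCount B Bᶜ → #B ≤ #C :=
    fun C h h' hC => hmin C (mem_filter.mpr ⟨(hS C).mpr ⟨h, h'⟩,
      (le_antisymm hC (hle C h h')).trans hBc⟩)
  obtain ⟨hB4, hB4'⟩ := (hS B).mp hBS
  have hBlt : G.adjCount B Bᶜ + 4 ≤ 3 * k := by have := hle A hA hA'; omega
  have hBbig := hbig B hB4 hBlt
  have hhalf : #B ≤ #Bᶜ := hsmall Bᶜ hB4' (by rwa [compl_compl]) (adjCount_compl_compl G B).le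
  have hcompl : ∀ C : Finset V, #C + #Cᶜ = #B + #Bᶜ := fun C => by
    rw [card_add_card_compl, card_add_card_compl]
  have hpos : 0 < G.adjCount B Bᶜ := by
    obtain ⟨u, hu⟩ := card_pos.mp (show 0 < #B by omega)
    obtain ⟨v, hv⟩ := card_pos.mp (show 0 < #Bᶜ by omega)
    exact adjCount_compl_pos_of_reachable (hconn.preconnected u v) hu (mem_compl.mp hv)
  have hcard := card_le_adjCount_compl_of_isBlock htrans hpos fun φ => ?_
  · omega
  by_contra! hφ
  obtain ⟨hne, hdis⟩ := hφ
  set C := B.map φ.toEquiv.toEmbedding with hC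
  have hCB : #C = #B := card_map _
  have hCc : G.adjCount C Cᶜ = G.adjCount B Bᶜ := by
    rw [hC, ← adjCount_map G φ B Bᶜ]
    rw [compl_map_iso]
  have hCcompl := hcompl C
  have hinter : 0 < #(B ∩ C) := by
    rw [card_pos, inter_comm, ← not_disjoint_iff_nonempty_inter]
    exact hdis
  have hlt : #(B ∩ C) < #B := by
    refine card_lt_card (ssubset_of_subset_of_ne inter_subset_left fun h => hne ?_)
    exact (eq_of_subset_of_card_le (inter_eq_left.mp h) hCB.le).symm
  have hunion := card_union_add_card_inter B C
  have h1 := hcompl (B ∩ C)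
  have h2 := hcompl (B ∪ C)
  by_cases h4 : 4 ≤ #(B ∩ C)
  · have hsub := G.adjCount_compl_inter_add_union_le B C
    have h5 := hle (B ∪ C) (by omega) (by omega)
    have h6 := hsmall (B ∩ C) h4 (by omega) (by omega)
    omega
  · have hsub := G.adjCount_compl_sdiff_add_sdiff_le B C
    have e1 := card_sdiff_add_card_inter B C
    have e2 := card_sdiff_add_card_inter C B
    rw [inter_comm C B] at e2
    have h3 := hcompl (B \ C)
    have h7 := hcompl (C \ B)
    have h5 := hle (C \ B) (by omega) (by omega)
    have h6 := hsmall (B \ C) (by omega) (by omega) (by omega)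
    omega

theorem adjCount_compl_lower_bounds {G : SimpleGraph V} {k : ℕ} (hconn : G.Connected)
    (htrans : G.IsVertexTransitive) (hg : 5 ≤ G.egirth) (hk : 4 ≤ k)
    (hd : ∀ x, G.adjCount {x} univ = k) (A : Finset V) (hA : 0 < #A) (hA' : 0 < #Aᶜ) :
    k ≤ G.adjCount A Aᶜ ∧ (3 ≤ #A → 3 ≤ #Aᶜ → 3 * k ≤ G.adjCount A Aᶜ + 4) := by
  have hone : ∀ B : Finset V, #B = 1 → G.adjCount B Bᶜ = k := by
    intro B hB
    obtain ⟨x, rfl⟩ := card_eq_one.mp hB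
    rw [adjCount_singleton_compl, hd]
  have h1 := hone A
  have h1' := hone Aᶜ
  have h2 := adjCount_compl_lower_bounds_small hg hd A
  have h2' := adjCount_compl_lower_bounds_small hg hd Aᶜ
  have h3 := three_mul_lt_adjCount_compl hconn htrans hg hk hd (A := A)
  rw [adjCount_compl_compl] at h1' h2'
  omega

end

section

open Finset
open scoped Classical
variable {V : Type*}

/-! ### Deleting fewer edges than the degree -/

theorem one_lt_encard_supp_of_adj {G : SimpleGraph V} (h : ∀ x, ∃ y, G.Adj x y)
    (C : G.ConnectedComponent) : 1 < C.supp.encard := by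
  obtain ⟨x, rfl⟩ := C.exists_rep
  obtain ⟨y, hxy⟩ := h x
  rw [Set.one_lt_encard_iff]
  exact ⟨x, y, rfl, ConnectedComponent.eq.mpr hxy.symm.reachable, hxy.ne⟩

theorem Reachable.exists_adj_of_ne {G : SimpleGraph V} {x y : V} (h : G.Reachable x y)
    (hxy : x ≠ y) : ∃ z, G.Adj x z := by
  obtain ⟨w⟩ := h
  cases w with
  | nil => exact absurd rfl hxy
  | cons h _ => exact ⟨_, h⟩

theorem adjCount_deleteEdges_add (G : SimpleGraph V) {F : Set (Sym2 V)} (hF : F ⊆ G.edgeSet)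
    (A B : Finset V) :
    (G.deleteEdges F).adjCount A B + (fromEdgeSet F).adjCount A B = G.adjCount A B := by
  simp only [adjCount, ← sum_add_distrib]
  refine sum_congr rfl fun x _ => sum_congr rfl fun y _ => ?_
  have h1 : s(x, y) ∈ F → G.Adj x y := fun h => hF h
  have h2 : G.Adj x y → x ≠ y := fun h => h.ne
  by_cases s(x, y) ∈ F <;> by_cases G.Adj x y <;> simp_all

variable [Fintype V]

theorem adjCount_fromEdgeSet_compl_le {F : Set (Sym2 V)} {q : ℕ} (hq : F.encard ≤ q)
    (A : Finset V) : (fromEdgeSet F).adjCount A Aᶜ ≤ q := by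
  have h : ((fromEdgeSet F).edgeBdry ↑A).encard ≤ F.encard := by
    refine Set.encard_le_encard fun e he => ?_
    have := he.1
    rw [edgeSet_fromEdgeSet] at this
    exact this.1
  rw [encard_edgeBdry] at h
  exact_mod_cast h.trans hq

theorem adjCount_fromEdgeSet_compl_lt {F : Set (Sym2 V)} {q : ℕ} (hq : F.encard ≤ q)
    {A : Finset V} {x y : V} (hx : x ∈ A) (hy : y ∈ A) (hxy : s(x, y) ∈ F) :
    (fromEdgeSet F).adjCount A Aᶜ < q := by
  have h : ((fromEdgeSet F).edgeBdry ↑A).encard < F.encard := by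
    refine Set.Finite.encard_lt_encard (Set.toFinite _)
      (Set.ssubset_iff_exists.mpr ⟨fun e he => ?_, s(x, y), hxy, ?_⟩)
    · have := he.1
      rw [edgeSet_fromEdgeSet] at this
      exact this.1
    · rintro ⟨-, a, ha, b, hb, he⟩
      rcases Sym2.eq_iff.mp he with ⟨rfl, rfl⟩ | ⟨rfl, rfl⟩
      · exact hb hy
      · exact hb hx
  rw [encard_edgeBdry] at h
  exact_mod_cast h.trans_le hq

/-- Deleting at most `k - 1` edges leaves the graph connected. -/
theorem connected_deleteEdges {G : SimpleGraph V} {k : ℕ} (hconn : G.Connected)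
    (htrans : G.IsVertexTransitive) (hg : 5 ≤ G.egirth) (hk : 4 ≤ k)
    (hd : ∀ x, G.adjCount {x} univ = k) {F : Set (Sym2 V)} (hF : F ⊆ G.edgeSet)
    (hq : F.encard ≤ (k - 1 : ℕ)) : (G.deleteEdges F).Connected := by
  have := hconn.nonempty
  refine ⟨fun u v => ?_⟩
  by_contra huv
  let A : Finset V := {w | (G.deleteEdges F).Reachable u w}
  have h0 : (G.deleteEdges F).adjCount A Aᶜ = 0 := by
    rw [adjCount]
    refine sum_eq_zero fun x hx => sum_eq_zero fun y hy => if_neg fun hxy => ?_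
    simp only [A, mem_compl, mem_filter, mem_univ, true_and] at hx hy
    exact hy (hx.trans hxy.reachable)
  have h1 := (adjCount_compl_lower_bounds hconn htrans hg hk hd A
    (card_pos.mpr ⟨u, by simp [A]⟩) (card_pos.mpr ⟨v, by simpa [A] using huv⟩)).1
  have h2 := adjCount_deleteEdges_add G hF A Aᶜ
  have h3 := adjCount_fromEdgeSet_compl_le hq A
  omega

/-- The boundary of an edge `uv` of `G - F` in `G - F` has `2k - 2` edges, less the numbers of edges
of `F` at `u` and at `v`. -/
theorem adjCount_deleteEdges_pair {G : SimpleGraph V} {k : ℕ}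
    (hd : ∀ x, G.adjCount {x} univ = k) {F : Set (Sym2 V)} (hF : F ⊆ G.edgeSet) {u v : V}
    (huv : (G.deleteEdges F).Adj u v) :
    (G.deleteEdges F).adjCount {u, v} {u, v}ᶜ + 2 + (fromEdgeSet F).adjCount {u} univ +
      (fromEdgeSet F).adjCount {v} univ = 2 * k := by
  have h1 := (G.deleteEdges F).adjCount_pair huv.ne
  rw [if_pos huv] at h1
  have h2 := adjCount_deleteEdges_add G hF {u} univ
  have h3 := adjCount_deleteEdges_add G hF {v} univ
  rw [hd] at h2 h3
  omega

/-- The tight case: three vertices inducing a path in `G`, with no edge of `F` inside the set. At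
least three edges of `F` leave the set, so the two ends of one of the two edges of the path together
meet at least two of them. -/
theorem exists_adj_of_card_eq_three {G : SimpleGraph V} {k : ℕ} (hd : ∀ x, G.adjCount {x} univ = k)
    {F : Set (Sym2 V)} {A : Finset V} (hA : #A = 3) (hc : G.adjCount A Aᶜ + 4 = 3 * k)
    (hFA : 3 ≤ (fromEdgeSet F).adjCount A Aᶜ) (hin : ∀ x ∈ A, ∀ y ∈ A, s(x, y) ∉ F) :
    ∃ u v, (G.deleteEdges F).Adj u v ∧
      2 ≤ (fromEdgeSet F).adjCount {u} univ + (fromEdgeSet F).adjCount {v} univ := by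
  by_contra! h
  have hadj : ∀ x ∈ A, ∀ y ∈ A, G.Adj x y →
      (fromEdgeSet F).adjCount {x} univ + (fromEdgeSet F).adjCount {y} univ < 2 :=
    fun x hx y hy hxy => h x y (by rw [deleteEdges_adj]; exact ⟨hxy, hin x hx y hy⟩)
  have h2 := G.adjCount_compl_add_adjCount_self A
  simp only [hd, sum_const, smul_eq_mul, hA] at h2
  have h4 : G.adjCount A A = 4 := by omega
  have h5 := (fromEdgeSet F).adjCount_compl_add_adjCount_self A
  obtain ⟨a, b, c, hab, hac, hbc, rfl⟩ := card_eq_three.mp hA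
  have hab' := hadj a (by simp) b (by simp)
  have hac' := hadj a (by simp) c (by simp)
  have hbc' := hadj b (by simp) c (by simp)
  rw [sum_insert (by simp [hab, hac]), sum_pair hbc] at h5
  rw [adjCount, sum_insert (by simp [hab, hac]), sum_pair hbc] at h4
  simp only [sum_insert (show a ∉ ({b, c} : Finset V) by simp [hab, hac]), sum_pair hbc,
    SimpleGraph.irrefl, if_false, G.adj_comm b a, G.adj_comm c a, G.adj_comm c b] at h4
  by_cases i1 : G.Adj a b <;> by_cases i2 : G.Adj a c <;> by_cases i3 : G.Adj b c <;>
    simp only [i1, i2, i3, if_true, if_false, true_imp_iff] at h4 hab' hac' hbc' <;> omega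

/-- After the deletion of at most `k - 1` edges, the boundary of some edge is smaller than that of
any set with at least three vertices inside and outside. -/
theorem exists_adj_adjCount_lt {G : SimpleGraph V} {k : ℕ} (hconn : G.Connected)
    (htrans : G.IsVertexTransitive) (hg : 5 ≤ G.egirth) (hk : 4 ≤ k)
    (hd : ∀ x, G.adjCount {x} univ = k) {F : Set (Sym2 V)} (hF : F ⊆ G.edgeSet)
    (hq : F.encard ≤ (k - 1 : ℕ)) {A : Finset V} (hA : 3 ≤ #A) (hA' : 3 ≤ #Aᶜ) :
    ∃ u v, (G.deleteEdges F).Adj u v ∧ (G.deleteEdges F).adjCount {u, v} {u, v}ᶜ <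
      (G.deleteEdges F).adjCount A Aᶜ := by
  have hlow := (adjCount_compl_lower_bounds hconn htrans hg hk hd A (by omega) (by omega)).2 hA hA'
  have hsum := adjCount_deleteEdges_add G hF A Aᶜ
  have hFA := adjCount_fromEdgeSet_compl_le hq A
  have hdeg : ∀ x, (G.deleteEdges F).adjCount {x} univ + (fromEdgeSet F).adjCount {x} univ = k ∧
      (fromEdgeSet F).adjCount {x} univ ≤ k - 1 := by
    intro x
    refine ⟨by rw [adjCount_deleteEdges_add G hF, hd], ?_⟩
    rw [← adjCount_singleton_compl]
    exact adjCount_fromEdgeSet_compl_le hq {x}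
  have hnbr : ∀ x, ∃ y, (G.deleteEdges F).Adj x y := by
    intro x
    have h1 : 0 < (G.deleteEdges F).adjCount {x} univ := by have := hdeg x; omega
    obtain ⟨y, -, hy⟩ := adjCount_singleton_pos.mp h1
    exact ⟨y, hy⟩
  by_cases hF0 : (fromEdgeSet F).adjCount A Aᶜ = 0
  · obtain ⟨x⟩ := hconn.nonempty
    obtain ⟨y, hxy⟩ := hnbr x
    have := adjCount_deleteEdges_pair hd hF hxy
    exact ⟨x, y, hxy, by omega⟩
  by_cases hFlt : (fromEdgeSet F).adjCount A Aᶜ + 1 < k ∨ 3 * k < G.adjCount A Aᶜ + 4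
  · -- an edge of `G - F` adjacent to one of `F` is good enough
    obtain ⟨x, hx, hx0⟩ : ∃ x ∈ A, 0 < (fromEdgeSet F).adjCount {x} Aᶜ := by
      rw [adjCount_eq_sum_singleton] at hF0
      exact sum_pos_iff.mp (Nat.pos_of_ne_zero hF0)
    have hx1 : 0 < (fromEdgeSet F).adjCount {x} univ := by
      obtain ⟨y, -, hy⟩ := adjCount_singleton_pos.mp hx0
      exact adjCount_singleton_pos.mpr ⟨y, mem_univ y, hy⟩
    obtain ⟨y, hxy⟩ := hnbr x
    have := adjCount_deleteEdges_pair hd hF hxy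
    exact ⟨x, y, hxy, by omega⟩
  · push Not at hFlt
    have hin : (∀ x ∈ A, ∀ y ∈ A, s(x, y) ∉ F) ∧ ∀ x ∈ Aᶜ, ∀ y ∈ Aᶜ, s(x, y) ∉ F := by
      refine ⟨fun x hx y hy h => ?_, fun x hx y hy h => ?_⟩
      · have := adjCount_fromEdgeSet_compl_lt hq hx hy h
        omega
      · have := adjCount_fromEdgeSet_compl_lt hq hx hy h
        rw [adjCount_compl_compl] at this
        omega
    obtain ⟨u, v, huv, h2⟩ : ∃ u v, (G.deleteEdges F).Adj u v ∧
        2 ≤ (fromEdgeSet F).adjCount {u} univ + (fromEdgeSet F).adjCount {v} univ := by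
      have h4 : ¬ (4 ≤ #A ∧ 4 ≤ #Aᶜ) := fun h => by
        have := three_mul_lt_adjCount_compl hconn htrans hg hk hd h.1 h.2
        omega
      by_cases h3 : #A = 3
      · exact exists_adj_of_card_eq_three hd h3 (by omega) (by omega) hin.1
      · refine exists_adj_of_card_eq_three hd (A := Aᶜ) (by omega) ?_ ?_ hin.2 <;>
          rw [adjCount_compl_compl] <;> omega
    have := adjCount_deleteEdges_pair hd hF huv
    exact ⟨u, v, huv, by omega⟩

/-! ### Extra edge-cuts -/

/-- If `uv` is an edge of `G - F` of least boundary, that boundary is a `1`-extra edge-cut. A vertex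
`w` isolated by it would have degree one in `G - F`, with its neighbour among `u`, `v`, say `u`; since
the boundary of `uw` is no smaller, `v` would have degree one as well, which takes more than `k - 1`
edges of `F`. -/
theorem isExtraEdgeCut_edgeBdry_pair {G : SimpleGraph V} {k : ℕ} (hconn : G.Connected)
    (htrans : G.IsVertexTransitive) (hg : 5 ≤ G.egirth) (hk : 4 ≤ k)
    (hd : ∀ x, G.adjCount {x} univ = k) {F : Set (Sym2 V)} (hF : F ⊆ G.edgeSet)
    (hq : F.encard ≤ (k - 1 : ℕ)) {u v : V} (huv : (G.deleteEdges F).Adj u v)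
    (hmin : ∀ x y, (G.deleteEdges F).Adj x y → (G.deleteEdges F).adjCount {u, v} {u, v}ᶜ ≤
      (G.deleteEdges F).adjCount {x, y} {x, y}ᶜ) :
    (G.deleteEdges F).IsExtraEdgeCut 1 ((G.deleteEdges F).edgeBdry ↑({u, v} : Finset V)) := by
  have hsub : (G.deleteEdges F) ≤ G := deleteEdges_le F
  have hconn' := connected_deleteEdges hconn htrans hg hk hd hF hq
  have hdeg : ∀ x, (G.deleteEdges F).adjCount {x} univ + (fromEdgeSet F).adjCount {x} univ = k :=
    fun x => by rw [adjCount_deleteEdges_add G hF, hd]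
  have key : ∀ u v w : V, w ≠ v → (G.deleteEdges F).Adj u v → (∀ x y, (G.deleteEdges F).Adj x y →
      (G.deleteEdges F).adjCount {u, v} {u, v}ᶜ ≤ (G.deleteEdges F).adjCount {x, y} {x, y}ᶜ) →
      (G.deleteEdges F).Adj w u → ∃ y, y ≠ u ∧ y ≠ v ∧ (G.deleteEdges F).Adj w y := by
    intro u v w hwv huv hmin hwu
    by_contra! h
    have hw1 := adjCount_singleton_le_one (G := G.deleteEdges F) (x := w) (u := u) (fun y hy => by
      by_contra hyu
      by_cases hyv : y = v
      · subst hyv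
        exact not_adj_of_common_neighbor hg (hsub hwu) (hsub huv) (hsub hy)
      · exact h y hyu hyv hy) univ
    have h1 := (G.deleteEdges F).adjCount_pair huv.ne
    have h2 := (G.deleteEdges F).adjCount_pair hwu.ne'
    have h3 := hmin u w hwu.symm
    rw [if_pos huv] at h1
    rw [if_pos hwu.symm] at h2
    have h4 := hdeg v
    have h5 := hdeg w
    have h6 := (fromEdgeSet F).adjCount_pair hwv
    have h7 := adjCount_fromEdgeSet_compl_le hq {w, v}
    split_ifs at h6 <;> omega
  have hstay : ∀ x y, (x ∈ ({u, v} : Finset V) ↔ y ∈ ({u, v} : Finset V)) →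
      (G.deleteEdges F).Adj x y → ((G.deleteEdges F).deleteEdges
        ((G.deleteEdges F).edgeBdry ↑({u, v} : Finset V))).Adj x y := by
    intro x y hiff hxy
    rw [deleteEdges_adj]
    refine ⟨hxy, ?_⟩
    rintro ⟨-, a, ha, b, hb, he⟩
    rw [Finset.mem_coe] at ha hb
    rcases Sym2.eq_iff.mp he with ⟨rfl, rfl⟩ | ⟨rfl, rfl⟩ <;> tauto
  refine ⟨fun e he => he.1, fun hpre => ?_, ?_⟩
  · have h1 := G.adjCount_pair huv.ne
    rw [if_pos (hsub huv), hd, hd] at h1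
    have h2 : 0 < G.adjCount {u, v} {u, v}ᶜ := by omega
    rw [adjCount_eq_sum_singleton] at h2
    obtain ⟨x, hx, hx0⟩ := sum_pos_iff.mp h2
    obtain ⟨y, hy, -⟩ := adjCount_singleton_pos.mp hx0
    have h3 := adjCount_compl_pos_of_reachable (hpre x y) hx (mem_compl.mp hy)
    rw [adjCount_eq_sum_singleton] at h3
    obtain ⟨a, ha, ha0⟩ := sum_pos_iff.mp h3
    obtain ⟨b, hb, hab⟩ := adjCount_singleton_pos.mp ha0
    rw [deleteEdges_adj] at hab
    exact hab.2 ⟨hab.1, a, ha, b, mem_compl.mp hb, rfl⟩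
  · refine one_lt_encard_supp_of_adj fun w => ?_
    by_cases hwu : w = u
    · exact ⟨v, hstay w v (by simp [hwu]) (hwu ▸ huv)⟩
    by_cases hwv : w = v
    · exact ⟨u, hstay w u (by simp [hwv]) (hwv ▸ huv.symm)⟩
    obtain ⟨y, hyu, hyv, hy⟩ : ∃ y, y ≠ u ∧ y ≠ v ∧ (G.deleteEdges F).Adj w y := by
      by_cases h1 : (G.deleteEdges F).Adj w u
      · exact key u v w hwv huv hmin h1
      by_cases h2 : (G.deleteEdges F).Adj w v
      · obtain ⟨y, h3, h4, h5⟩ := key v u w hwu huv.symm (by rwa [pair_comm]) h2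
        exact ⟨y, h4, h3, h5⟩
      obtain ⟨y, hy⟩ := (hconn'.preconnected w u).exists_adj_of_ne hwu
      exact ⟨y, fun h => h1 (h ▸ hy), fun h => h2 (h ▸ hy), hy⟩
    exact ⟨y, hstay w y (by simp [hwu, hwv, hyu, hyv]) hy⟩

/-- A `1`-extra edge-cut of `G - F` has at least as many edges as the smallest boundary `c` of an edge,
and if it has no more then it cuts off a single edge. -/
theorem le_encard_of_isExtraEdgeCut {G : SimpleGraph V} {k c : ℕ} (hconn : G.Connected)
    (htrans : G.IsVertexTransitive) (hg : 5 ≤ G.egirth) (hk : 4 ≤ k)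
    (hd : ∀ x, G.adjCount {x} univ = k) {F : Set (Sym2 V)} (hF : F ⊆ G.edgeSet)
    (hq : F.encard ≤ (k - 1 : ℕ))
    (hmin : ∀ x y, (G.deleteEdges F).Adj x y → c ≤ (G.deleteEdges F).adjCount {x, y} {x, y}ᶜ)
    {F' : Set (Sym2 V)} (hF' : (G.deleteEdges F).IsExtraEdgeCut 1 F') :
    (c : ℕ∞) ≤ F'.encard ∧ (F'.encard ≤ c →
      ∃ C : ((G.deleteEdges F).deleteEdges F').ConnectedComponent, C.supp.encard = 2) := by
  obtain ⟨-, hpre, hsize⟩ := hF'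
  generalize hH : G.deleteEdges F = H at *
  have hbdry : ∀ C : (H.deleteEdges F').ConnectedComponent, H.edgeBdry C.supp ⊆ F' := by
    rintro C e ⟨he, x, hx, y, hy, rfl⟩
    by_contra hxy
    refine hy ?_
    have hadj : (H.deleteEdges F').Adj x y := by
      rw [deleteEdges_adj]
      exact ⟨he, hxy⟩
    exact (C.mem_supp_congr_adj hadj).mp hx
  have htwo : ∀ C : (H.deleteEdges F').ConnectedComponent, C.supp.encard = 2 →
      (c : ℕ∞) ≤ F'.encard := by
    intro C hC
    obtain ⟨a, b, hab, hCab⟩ := Set.encard_eq_two.mp hC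
    have ha : a ∈ C.supp := by simp [hCab]
    have hb : b ∈ C.supp := by simp [hCab]
    have hreach : (H.deleteEdges F').Reachable a b :=
      ConnectedComponent.exact (ha.trans hb.symm)
    obtain ⟨y, hay⟩ := hreach.exists_adj_of_ne hab
    have hy : y ∈ C.supp := (C.mem_supp_congr_adj hay).mp ha
    rw [hCab] at hy
    obtain rfl : y = b := hy.resolve_left hay.ne'
    have h1 := Set.encard_le_encard (hbdry C)
    rw [hCab, ← coe_pair, encard_edgeBdry] at h1
    exact le_trans (by exact_mod_cast hmin a y (deleteEdges_le F' hay)) h1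
  by_cases hex : ∃ C : (H.deleteEdges F').ConnectedComponent, C.supp.encard = 2
  · obtain ⟨C, hC⟩ := hex
    exact ⟨htwo C hC, fun _ => ⟨C, hC⟩⟩
  simp only [Preconnected, not_forall] at hpre
  obtain ⟨u, v, huv⟩ := hpre
  have hthree : ∀ C : (H.deleteEdges F').ConnectedComponent, 3 ≤ #C.supp.toFinset := by
    intro C
    have h1 := hsize C
    have h2 : C.supp.encard ≠ 2 := fun h => hex ⟨C, h⟩
    rw [← Set.coe_toFinset C.supp, Set.encard_coe_eq_coe_finsetCard] at h1 h2
    have h3 : 1 < #C.supp.toFinset := by exact_mod_cast h1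
    have h4 : #C.supp.toFinset ≠ 2 := by exact_mod_cast h2
    omega
  let C := (H.deleteEdges F').connectedComponentMk u
  let C' := (H.deleteEdges F').connectedComponentMk v
  have hdis : C'.supp.toFinset ⊆ C.supp.toFinsetᶜ := by
    intro x hx
    rw [mem_compl, Set.mem_toFinset]
    rw [Set.mem_toFinset] at hx
    exact fun hx' => huv (ConnectedComponent.exact (hx'.symm.trans hx))
  obtain ⟨x, y, hxy, hlt⟩ := exists_adj_adjCount_lt hconn htrans hg hk hd hF hq (hthree C)
    ((hthree C').trans (card_le_card hdis))
  rw [hH] at hxy hlt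
  have h1 := Set.encard_le_encard (hbdry C)
  rw [← Set.coe_toFinset C.supp, encard_edgeBdry] at h1
  have h2 : (c : ℕ∞) < F'.encard :=
    lt_of_lt_of_le (by exact_mod_cast (hmin x y hxy).trans_lt hlt) h1
  exact ⟨h2.le, fun h => absurd h2 h.not_gt⟩

theorem extraXi_one_eq {G : SimpleGraph V} {u v : V} (huv : G.Adj u v)
    (hmin : ∀ x y, G.Adj x y → G.adjCount {u, v} {u, v}ᶜ ≤ G.adjCount {x, y} {x, y}ᶜ) :
    G.extraXi 1 = G.adjCount {u, v} {u, v}ᶜ := by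
  refine le_antisymm ?_ (le_iInf₂ ?_)
  · rw [← encard_edgeBdry]
    refine iInf₂_le (↑({u, v} : Finset V) : Set V) ⟨?_, ?_⟩
    · rw [coe_pair, Set.encard_pair huv.ne]
      norm_num
    · rw [coe_pair]
      exact induce_pair_connected_of_adj huv
  · rintro X ⟨hX, hXc⟩
    obtain ⟨a, b, hab, rfl⟩ := Set.encard_eq_two.mp (hX.trans (by norm_num))
    obtain ⟨⟨y, hy⟩, hay⟩ := (hXc.preconnected ⟨a, by simp⟩ ⟨b, by simp⟩).exists_adj_of_ne
      (by simpa using hab)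
    have hay' : G.Adj a y := hay
    obtain rfl : y = b := hy.resolve_left hay'.ne'
    rw [← coe_pair, encard_edgeBdry]
    exact_mod_cast hmin a y hay'

theorem isSuperExtra_deleteEdges {G : SimpleGraph V} {k : ℕ} (hconn : G.Connected)
    (htrans : G.IsVertexTransitive) (hg : 5 ≤ G.egirth) (hk : 4 ≤ k)
    (hd : ∀ x, G.adjCount {x} univ = k) {F : Set (Sym2 V)} (hF : F ⊆ G.edgeSet)
    (hq : F.encard ≤ (k - 1 : ℕ)) : (G.deleteEdges F).IsSuperExtra 1 := by
  have hconn' := connected_deleteEdges hconn htrans hg hk hd hF hq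
  obtain ⟨e, he⟩ : ∃ e : V × V, (G.deleteEdges F).Adj e.1 e.2 := by
    obtain ⟨x⟩ := hconn.nonempty
    obtain ⟨y, -, hxy⟩ := adjCount_singleton_pos.mp (show 0 < G.adjCount {x} univ by rw [hd]; omega)
    obtain ⟨z, hxz⟩ := (hconn'.preconnected x y).exists_adj_of_ne hxy.ne
    exact ⟨(x, z), hxz⟩
  obtain ⟨⟨u, v⟩, huv, hmin⟩ := exists_min_image {e : V × V | (G.deleteEdges F).Adj e.1 e.2}
    (fun e => (G.deleteEdges F).adjCount {e.1, e.2} {e.1, e.2}ᶜ) ⟨e, by simpa using he⟩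
  replace huv : (G.deleteEdges F).Adj u v := (mem_filter.mp huv).2
  replace hmin : ∀ x y, (G.deleteEdges F).Adj x y →
      (G.deleteEdges F).adjCount {u, v} {u, v}ᶜ ≤ (G.deleteEdges F).adjCount {x, y} {x, y}ᶜ :=
    fun x y hxy => hmin (x, y) (mem_filter.mpr ⟨mem_univ _, hxy⟩)
  have hcut := isExtraEdgeCut_edgeBdry_pair hconn htrans hg hk hd hF hq huv hmin
  have hle := fun F' hF' =>
    le_encard_of_isExtraEdgeCut hconn htrans hg hk hd hF hq hmin (F' := F') hF'
  have hconnectivity : (G.deleteEdges F).extraEdgeConnectivity 1 =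
      (G.deleteEdges F).adjCount {u, v} {u, v}ᶜ := by
    refine le_antisymm ?_ (le_iInf₂ fun F' hF' => (hle F' hF').1)
    rw [← encard_edgeBdry]
    exact iInf₂_le _ hcut
  refine ⟨⟨hconn', ⟨_, hcut⟩, hconnectivity.trans (extraXi_one_eq huv hmin).symm⟩, ?_⟩
  intro F' hF' hF'c
  obtain ⟨C, hC⟩ := (hle F' hF').2 (hF'c.trans hconnectivity).le
  exact ⟨C, hC.trans (by norm_num)⟩

/-- The deletion of all `k` edges at a vertex isolates it. -/
theorem not_isSuperExtra_deleteEdges_edgeBdry_singleton {G : SimpleGraph V} {x : V}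
    (hx : 0 < G.adjCount {x} univ) {h : ℕ} :
    ¬ (G.deleteEdges (G.edgeBdry ↑({x} : Finset V))).IsSuperExtra h := by
  rintro ⟨⟨hconn, -⟩, -⟩
  obtain ⟨y, -, hxy⟩ := adjCount_singleton_pos.mp hx
  obtain ⟨z, hz⟩ := (hconn.preconnected x y).exists_adj_of_ne hxy.ne
  rw [deleteEdges_adj] at hz
  exact hz.2 ⟨hz.1, x, by simp, z, by simpa using hz.1.ne', rfl⟩

end
end SimpleGraph

theorem corollary3p11 {V : Type*} [Fintype V] (G : SimpleGraph V) [DecidableRel G.Adj] (k : ℕ)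
    (hconn : G.Connected) (htrans : G.IsVertexTransitive) (hdeg : G.IsRegularOfDegree k)
    (hk : 4 ≤ k) (hgirth : 5 ≤ G.egirth) :
    G.IsPersistence 1 (k - 1) := by
  have hd : ∀ x, G.adjCount {x} Finset.univ = k := by
    intro x
    rw [SimpleGraph.adjCount_singleton, ← hdeg x, ← G.card_neighborFinset_eq_degree]
    congr 1
    ext y
    simp
  refine ⟨?_, fun F hF hq =>
    SimpleGraph.isSuperExtra_deleteEdges hconn htrans hgirth hk hd hF hq, fun m hm => ?_⟩
  · have h := SimpleGraph.isSuperExtra_deleteEdges hconn htrans hgirth hk hd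
      (Set.empty_subset G.edgeSet) (by simp)
    rwa [SimpleGraph.deleteEdges_empty] at h
  · obtain ⟨x⟩ := hconn.nonempty
    by_contra! hlt
    classical
    refine SimpleGraph.not_isSuperExtra_deleteEdges_edgeBdry_singleton (G := G) (x := x)
      (by rw [hd]; omega) (hm _ (fun e he => he.1) ?_)
    rw [SimpleGraph.encard_edgeBdry]
    have h := G.adjCount_singleton_compl x
    rw [hd] at h
    have h2 : k ≤ m := by omega
    calc _ = (k : ℕ∞) := by exact_mod_cast h
      _ ≤ m := by exact_mod_cast h2
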